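/- Let $n\ge 1$ and let $T$ be the one-column semistandard tableau with entries $i<j$, $1\le i<j\le n$. Assume that $T$ is non-frozen, i.e. $\{i,j\}$ is not a cyclic interval of $[n]=\{1,\dots,n\}$ (so $j\ne i+1$ and $(i,j)\neq(1,n)$). (As a one-column tableau, $T$ is automatically prime, so primeness need not be assumed.) Then $F_{2,n}(v_T)$ induces a split positroidal subdivision of the hypersimplex $\Delta(2,n)$, that is, the induced regular subdivision is a polytopal subdivision of $\Delta(2,n)$ all of whose cells are matroid polytopes of positroids of rank $2$ on $[n]$, and it has exactly two inclusion-maximal cells. Here: * $\mathrm{SSYT}(2,[n])$ is the set of rectangular semistandard tableaux with two rows and entries in $[n]$; $S\cup T$ is the row-increasing tableau whose rows are the multiset unions of the rows of $S$ and $T$; a tableau is trivial if each entry is one less than the entry below it; and $S\sim T$ means that $S$ and $T$ agree after removal of a maximal trivial factor. Every $T\in\mathrm{SSYT}(2,[n])$ satisfies $T\sim\bigcup_{l=1}^{n-2}T_l^{\cup c_l}$ for unique integers $c_l\ge 0$, where $T_l$ is the column with entries $l,l+2$; put $v_T=\sum_l c_l e_l\in\mathbb R^{n-2}$. * $F_{2,n}(y)\in\mathbb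 R^{\binom{[n]}{2}}/L$ is the class of $(P_J(y))_J$, where $L$ is the lineality space, consisting of the vectors $\bigl(\sum_{a\in J}u_a\bigr)_J$ with $u\in\mathbb R^n$, and $P_J$ is the tropicalization (minimum over the occurring monomials) of the $2\times2$ minor with column set $J$ of the web matrix $$\begin{pmatrix}1&0&-x_1&-(x_1+x_2)&\cdots&-(x_1+\cdots+x_{n-2})\\0&1&1&1&\cdots&1\end{pmatrix}.$$ * $\Delta(2,n)$ is the convex hull of the vectors $e_J=\sum_{a\in J}e_a$, $J\in\binom{[n]}{2}$. The regular subdivision induced by the class of $w\in\mathbb R^{\binom{[n]}{2}}$ consists of the projections to $\mathbb R^n$ of the (non-empty) lower faces of $\mathrm{conv}\{(e_J,w_J)\}\subset\mathbb R^n\times\mathbb R$; it depends only on $w$ modulo $L$. * A polytopal subdivision of a polytope $P$ is a finite collection of polytopes with union $P$, any two of which meet in a (possibly empty) common face, and whose vertices are vertices of $P$. A positroid of rank $2$ on $[n]$ is a matroid represented by a real $2\times n$ matrix all of whose $2\times2$ minors are non-negative; its matroid polytope is the convex hull of the vectors $e_B$, $B$ a basis. -/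

import Mathlib

noncomputable section

namespace PositroidalSubdivision

/-! ### Rectangular tableaux -/

/-- A row-increasing tableau with `k` rows, recorded by the multiset of entries of each row
(a weakly increasing row is determined by its multiset of entries).  With this encoding the
union `S ∪ T` of tableaux is the sum `S + T`, `S` is a factor of `T` iff `S ≤ T`, and the
quotient is `T - S`. -/
abbrev RowTableau (k : ℕ) := Fin k → Multiset ℕ

/-- `T` is a rectangular semistandard Young tableau with `k` rows and entries in `{1, …, n}`:
it has a filling `E` (row `r`, column `s`) with weakly increasing rows and strictly
increasing columns. -/
def IsSSYT (k n : ℕ) (T : RowTableau k) : Prop :=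
  ∃ (m : ℕ) (E : Fin k → Fin m → ℕ),
    (∀ r s, 1 ≤ E r s ∧ E r s ≤ n) ∧
    (∀ r, Monotone (E r)) ∧
    (∀ s, StrictMono (fun r => E r s)) ∧
    ∀ r, T r = (Finset.univ : Finset (Fin m)).val.map (E r)

/-- The set `SSYT(k, [n])`, with arbitrarily many columns. -/
def SSYT (k n : ℕ) := {T : RowTableau k // IsSSYT k n T}

/-- The one-column tableau with entries `c 0, c 1, …` from top to bottom. -/
def column {k : ℕ} (c : Fin k → ℕ) : RowTableau k := fun r => {c r}

/-- A tableau is trivial if each entry is one less than the entry below it, that is, each row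
is obtained from the row above it by adding one to all entries. -/
def IsTrivial {k : ℕ} (A : RowTableau k) : Prop :=
  ∀ r s : Fin k, (s : ℕ) = r + 1 → A s = (A r).map (· + 1)

/-- `R = T_red`: the tableau `R` is obtained from `T` by removing a maximal trivial factor. -/
def IsReduction {k : ℕ} (T R : RowTableau k) : Prop :=
  ∃ A : RowTableau k, Maximal (fun A => IsTrivial A ∧ A ≤ T) A ∧ R = T - A

/-- The relation `S ∼ T`, that is, `S_red = T_red`. -/
def TabEquiv {k : ℕ} (S T : RowTableau k) : Prop :=
  ∃ R : RowTableau k, IsReduction S R ∧ IsReduction T R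

/-- `T` is a frozen one-column tableau: its entries form a cyclic interval
`a + 1, …, a + k` modulo `n` in `{1, …, n}`. -/
def IsFrozen {k : ℕ} (n : ℕ) (T : RowTableau k) : Prop :=
  ∃ c : Fin k → ℕ, StrictMono c ∧ T = column c ∧
    ∃ a : ℕ, Set.range c = {x | ∃ s : Fin k, x = (a + s) % n + 1}

/-- The tableau with one column `i < j` in `SSYT(2, [n])`. -/
def oneColumn {n i j : ℕ} (hi : 1 ≤ i) (hij : i < j) (hj : j ≤ n) : SSYT 2 n :=
  ⟨column ![i, j], 1, fun r _ => ![i, j] r, by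
    refine ⟨?_, fun r => monotone_const, ?_, ?_⟩
    · intro r s
      fin_cases r <;> simp <;> omega
    · intro s r r' h
      fin_cases r <;> fin_cases r' <;> simp_all
    · intro r
      fin_cases r <;> simp [column]⟩

/-- The fundamental tableaux for two rows.  For `l = j - 1` with `j ∈ {1, …, n - 2}` this is the
column with entries `{j, j + 1, j + 2} \ {j + 1}`. -/
def fundamental {n : ℕ} (l : Fin (n - 2)) : RowTableau 2 :=
  column ![(l : ℕ) + 1, (l : ℕ) + 3]

/-- The small gap tableau `⋃_j T_{1,j}^{∪ c_j}`. -/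
def smallGap {n : ℕ} (c : Fin (n - 2) → ℕ) : RowTableau 2 := ∑ l, c l • fundamental l


theorem isTrivial_iff (A : RowTableau 2) :
    IsTrivial A ↔ ∀ x, (A 1).count (x + 1) = (A 0).count x ∧ (A 1).count 0 = 0 := by
  have h1 : IsTrivial A ↔ A 1 = (A 0).map (· + 1) := by
    constructor
    · intro h; exact h 0 1 rfl
    · intro h r s hrs
      fin_cases r <;> fin_cases s <;> simp at hrs ⊢
      exact h
  rw [h1, Multiset.ext]
  have hc : ∀ x, ((A 0).map (· + 1)).count (x + 1) = (A 0).count x := fun x =>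
    Multiset.count_map_eq_count' _ _ (add_left_injective 1) x
  have h0 : ((A 0).map (· + 1)).count 0 = 0 := by
    rw [Multiset.count_eq_zero]; simp
  constructor
  · intro h x
    exact ⟨by rw [h, hc], by rw [h, h0]⟩
  · rintro h (_ | x)
    · rw [h0, (h 0).2]
    · rw [hc, (h x).1]

theorem le_iff_count (A T : RowTableau 2) :
    A ≤ T ↔ ∀ x, (A 0).count x ≤ (T 0).count x ∧ (A 1).count x ≤ (T 1).count x := by
  rw [Pi.le_def, Fin.forall_fin_two, Multiset.le_iff_count, Multiset.le_iff_count, forall_and]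

theorem count_maximal {T A : RowTableau 2} (hA : Maximal (fun A => IsTrivial A ∧ A ≤ T) A)
    (x : ℕ) : (A 0).count x = min ((T 0).count x) ((T 1).count (x + 1)) := by
  obtain ⟨⟨ht, hle⟩, hmax⟩ := hA
  have ht' := (isTrivial_iff A).1 ht
  have hle' := (le_iff_count A T).1 hle
  apply le_antisymm
  · exact le_min (hle' x).1 ((ht' x).1 ▸ (hle' (x + 1)).2)
  · by_contra! hlt
    have hB : IsTrivial (A + column ![x, x + 1]) := by
      rw [isTrivial_iff]
      intro y
      have := ht' y
      simp [column, Multiset.count_singleton, this]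
    have hBT : A + column ![x, x + 1] ≤ T := by
      rw [le_iff_count]
      intro y
      have h1 := hle' y
      have h2 := (ht' x).1
      have h3 := lt_min_iff.1 hlt
      simp only [Pi.add_apply, column, Multiset.count_add, Multiset.count_singleton,
        Matrix.cons_val_zero, Matrix.cons_val_one]
      constructor
      · split_ifs with h
        · subst h; omega
        · omega
      · split_ifs with h
        · subst h; omega
        · omega
    have := (le_iff_count _ _).1 (hmax ⟨hB, hBT⟩ (by simp)) x
    simp [column] at this

theorem exists_maximal (T : RowTableau 2) :
    ∃ A, Maximal (fun A => IsTrivial A ∧ A ≤ T) A := by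
  have hfin : {A : RowTableau 2 | IsTrivial A ∧ A ≤ T}.Finite :=
    (Set.finite_Iic T).subset fun A hA => hA.2
  exact hfin.exists_maximal ⟨0, by intro r s _; simp, by intro r; simp⟩

theorem tabEquiv_iff (S T : RowTableau 2) : TabEquiv S T ↔
    (∀ x, (S 0).count x + (T 1).count (x + 1) = (T 0).count x + (S 1).count (x + 1)) ∧
      (S 1).count 0 = (T 1).count 0 := by
  constructor
  · rintro ⟨R, ⟨A, hA, rfl⟩, B, hB, hR⟩
    have hA0 := (isTrivial_iff A).1 hA.1.1
    have hB0 := (isTrivial_iff B).1 hB.1.1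
    have e0 := fun x => congrArg (Multiset.count x) (congrFun hR 0)
    have e1 := fun x => congrArg (Multiset.count x) (congrFun hR 1)
    simp only [Pi.sub_apply, Multiset.count_sub] at e0 e1
    constructor
    · intro x
      have a := e0 x
      have b := e1 (x + 1)
      rw [(hA0 x).1, (hB0 x).1] at b
      rw [count_maximal hA, count_maximal hB] at a b
      omega
    · have b := e1 0
      rwa [(hA0 0).2, (hB0 0).2] at b
  · rintro ⟨h, h'⟩
    obtain ⟨A, hA⟩ := exists_maximal S
    obtain ⟨B, hB⟩ := exists_maximal T
    have hA0 := (isTrivial_iff A).1 hA.1.1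
    have hB0 := (isTrivial_iff B).1 hB.1.1
    refine ⟨S - A, ⟨A, hA, rfl⟩, B, hB, ?_⟩
    funext r
    ext x
    simp only [Pi.sub_apply, Multiset.count_sub]
    fin_cases r
    · have := h x
      simp only [Fin.zero_eta, count_maximal hA, count_maximal hB]
      omega
    · simp only [Fin.mk_one]
      rcases x with _ | x
      · rw [(hA0 0).2, (hB0 0).2, h']
      · have := h x
        rw [(hA0 x).1, (hB0 x).1, count_maximal hA, count_maximal hB]
        omega

/-- Extension by zero of the multiplicities, indexed by `{1, …, n - 2}`. -/
def extZero {n : ℕ} (c : Fin (n - 2) → ℕ) (x : ℕ) : ℕ :=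
  ∑ l : Fin (n - 2), if x = (l : ℕ) + 1 then c l else 0

theorem smallGap_count {n : ℕ} (c : Fin (n - 2) → ℕ) (x : ℕ) :
    (smallGap c 0).count x = extZero c x ∧ (smallGap c 1).count (x + 2) = extZero c x := by
  simp [smallGap, extZero, fundamental, column, Finset.sum_apply, Multiset.count_sum',
    Multiset.count_singleton, Multiset.count_nsmul]

theorem smallGap_count_low {n : ℕ} (c : Fin (n - 2) → ℕ) :
    (smallGap c 1).count 0 = 0 ∧ (smallGap c 1).count 1 = 0 ∧ extZero c 0 = 0 := by
  simp [smallGap, extZero, fundamental, column, Finset.sum_apply]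

theorem extZero_apply {n : ℕ} (c : Fin (n - 2) → ℕ) (l : Fin (n - 2)) :
    extZero c (l + 1) = c l := by
  unfold extZero
  rw [Finset.sum_eq_single l] <;> simp +contextual [Fin.ext_iff, eq_comm]

theorem extZero_of {n : ℕ} (f : ℕ → ℕ) (h0 : f 0 = 0) (hf : ∀ x, n ≤ x + 1 → f x = 0) (x : ℕ) :
    extZero (fun l : Fin (n - 2) => f (l + 1)) x = f x := by
  rcases x with _ | x
  · rw [h0]; exact (smallGap_count_low _).2.2
  · by_cases hx : x < n - 2
    · exact extZero_apply (fun l : Fin (n - 2) => f (l + 1)) ⟨x, hx⟩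
    · rw [hf _ (by omega)]
      unfold extZero
      apply Finset.sum_eq_zero
      intro l _
      rw [if_neg]
      have := l.2
      omega

/-- Every tableau in `SSYT(2, [n])` is equivalent to a unique small gap tableau. -/
theorem existsUnique_smallGap {n : ℕ} (T : SSYT 2 n) :
    ∃! c : Fin (n - 2) → ℕ, TabEquiv T.1 (smallGap c) := by
  obtain ⟨T, m, E, hE, -, hcol, hT⟩ := T
  have hlt : ∀ s, E 0 s < E 1 s := fun s => hcol s (by decide)
  have cnt : ∀ r x, (T r).count x = ∑ s, if x = E r s then 1 else 0 := by
    intro r x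
    rw [hT, Multiset.count_map, ← Finset.filter_val, Finset.card_val, Finset.card_filter]
  have cnt0 : (T 1).count 0 = 0 := by
    rw [cnt]
    apply Finset.sum_eq_zero
    intro s _
    have := hE 1 s
    rw [if_neg (by omega)]
  refine existsUnique_of_exists_of_unique ?_ ?_
  · let f : ℕ → ℕ := fun x => ∑ s, if E 0 s ≤ x ∧ x + 1 < E 1 s then 1 else 0
    have hf0 : f 0 = 0 := by
      apply Finset.sum_eq_zero
      intro s _
      have := hE 0 s
      rw [if_neg (by omega)]
    have hfn : ∀ x, n ≤ x + 1 → f x = 0 := by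
      intro x hx
      apply Finset.sum_eq_zero
      intro s _
      have := hE 1 s
      rw [if_neg (by omega)]
    refine ⟨fun l => f (l + 1), ?_⟩
    rw [tabEquiv_iff]
    refine ⟨?_, by rw [cnt0, (smallGap_count_low _).1]⟩
    rintro (_ | x)
    · rw [(smallGap_count _ 0).1, (smallGap_count_low _).2.1, extZero_of f hf0 hfn, hf0, cnt, cnt]
      rw [zero_add, add_zero]
      apply Finset.sum_congr rfl
      intro s _
      have := hE 0 s
      have := hlt s
      rw [if_neg (by omega), if_neg (by omega)]
    · rw [(smallGap_count _ _).1, (smallGap_count _ x).2, extZero_of f hf0 hfn,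
        extZero_of f hf0 hfn, cnt, cnt]
      simp only [f, ← Finset.sum_add_distrib]
      apply Finset.sum_congr rfl
      intro s _
      have := hlt s
      split_ifs <;> omega
  · intro c c' h h'
    rw [tabEquiv_iff] at h h'
    have key : ∀ x, extZero c x = extZero c' x := by
      intro x
      induction x with
      | zero => rw [(smallGap_count_low c).2.2, (smallGap_count_low c').2.2]
      | succ x ih =>
        have a := h.1 (x + 1)
        have b := h'.1 (x + 1)
        rw [(smallGap_count _ _).1, (smallGap_count _ x).2] at a b
        omega
    funext l
    rw [← extZero_apply c, ← extZero_apply c', key]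

/-- The vector `v_T = ∑_j c_j e_j`, where `T ∼ ⋃_j T_{1,j}^{∪ c_j}`. -/
def vT {n : ℕ} (T : SSYT 2 n) : Fin (n - 2) → ℝ :=
  fun l => ((existsUnique_smallGap T).choose l : ℝ)

/-! ### The map of Speyer and Williams -/

/-- The set of `k`-element subsets of the ground set, `[n]` being modelled by `Fin n`
(the element `i` of `Fin n` is the element `i + 1` of `{1, …, n}`). -/
abbrev KSubset (k n : ℕ) := {J : Finset (Fin n) // J.card = k}

/-- The Plücker coordinate `p_J` of a `k × n` matrix: the maximal minor with column set `J`,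
columns in increasing order. -/
def plucker {R : Type*} [CommRing R] {k n : ℕ} (A : Matrix (Fin k) (Fin n) R)
    (J : KSubset k n) : R :=
  (A.submatrix id (J.1.orderEmbOfFin J.2)).det

/-- The web matrix for `k = 2`.  Its columns are `(1, 0)`, `(0, 1)` and
`(-(x_1 + ⋯ + x_j), 1)` for `j = 1, …, n - 2`; the variable `x_j` is `X l` with `l = j - 1`. -/
def webMatrix (n : ℕ) : Matrix (Fin 2) (Fin n) (MvPolynomial (Fin (n - 2)) ℝ) :=
  Matrix.of fun r c =>
    if (c : ℕ) = 0 then ![1, 0] r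
    else if (c : ℕ) = 1 then ![0, 1] r
    else ![-∑ l ∈ Finset.univ.filter (fun l : Fin (n - 2) => (l : ℕ) + 2 ≤ c),
      MvPolynomial.X l, 1] r

/-- The tropicalization of a nonzero polynomial with real coefficients: the minimum, over the
monomials which occur in it, of the values of the corresponding linear forms. -/
def trop {σ : Type*} [Fintype σ] (f : MvPolynomial σ ℝ) (y : σ → ℝ) : ℝ :=
  ⨅ m : f.support, ∑ l, (m.1 l : ℝ) * y l

/-- The `0/1` vector `e_J`. -/
def vertex {k n : ℕ} (J : KSubset k n) : Fin n → ℝ := fun i => if i ∈ J.1 then 1 else 0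

/-- The linear map which sends `u ∈ ℝⁿ` to the weight `J ↦ u · e_J`. -/
def linearWeight (k n : ℕ) : (Fin n → ℝ) →ₗ[ℝ] (KSubset k n → ℝ) where
  toFun u J := ∑ i, u i * vertex J i
  map_add' u v := by
    funext J
    simp [add_mul, Finset.sum_add_distrib]
  map_smul' a u := by
    funext J
    simp [mul_assoc, Finset.mul_sum]

/-- The lineality space `L`: the weights `J ↦ ∑_{j ∈ J} u_j`. -/
def lineality (k n : ℕ) : Submodule ℝ (KSubset k n → ℝ) := LinearMap.range (linearWeight k n)

/-- The map `F_{2,n} : ℝ^{n-2} → ℝ^{binom([n], 2)} / L`, with coordinates the tropical Plücker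
coordinates of the web matrix. -/
def speyerWilliams (n : ℕ) (y : Fin (n - 2) → ℝ) : (KSubset 2 n → ℝ) ⧸ lineality 2 n :=
  (lineality 2 n).mkQ fun J => trop (plucker (webMatrix n) J) y

/-! ### Subdivisions -/

/-- The hypersimplex `Δ(k, n)`. -/
def hypersimplex (k n : ℕ) : Set (Fin n → ℝ) :=
  convexHull ℝ (Set.range (vertex : KSubset k n → Fin n → ℝ))

/-- A polytope: the convex hull of finitely many points. -/
def IsPolytope {d : ℕ} (P : Set (Fin d → ℝ)) : Prop :=
  ∃ V : Set (Fin d → ℝ), V.Finite ∧ P = convexHull ℝ V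

/-- `C` is a polytopal subdivision of `P`: a finite collection of polytopes which cover `P`, such
that any two of them meet in a (possibly empty) face of both, and whose vertices are vertices of
`P`.  The faces of a polytope are its exposed faces. -/
def IsSubdivision {d : ℕ} (P : Set (Fin d → ℝ)) (C : Set (Set (Fin d → ℝ))) : Prop :=
  C.Finite ∧ (∀ Q ∈ C, IsPolytope Q) ∧
    (∀ Q ∈ C, ∀ Q' ∈ C, IsExposed ℝ Q (Q ∩ Q') ∧ IsExposed ℝ Q' (Q ∩ Q')) ∧
    ⋃₀ C = P ∧ ∀ Q ∈ C, Q.extremePoints ℝ ⊆ P.extremePoints ℝ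

/-- A positroid of rank `k` on `[n]`: a matroid represented by a real `k × n` matrix all of whose
maximal minors are non-negative. -/
def IsPositroid {n : ℕ} (k : ℕ) (M : Matroid (Fin n)) : Prop :=
  M.E = Set.univ ∧ ∃ A : Matrix (Fin k) (Fin n) ℝ, (∀ J, 0 ≤ plucker A J) ∧
    ∀ B : Set (Fin n), M.IsBase B ↔ ∃ J : KSubset k n, (J.1 : Set (Fin n)) = B ∧ plucker A J ≠ 0

open Classical in
/-- The matroid polytope: the convex hull of the indicator vectors of the bases. -/
def matroidPolytope {n : ℕ} (M : Matroid (Fin n)) : Set (Fin n → ℝ) :=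
  convexHull ℝ {x | ∃ B, M.IsBase B ∧ x = fun i => if i ∈ B then 1 else 0}

/-- A positroidal subdivision of `Δ(k, n)`. -/
def IsPositroidalSubdivision (k n : ℕ) (C : Set (Set (Fin n → ℝ))) : Prop :=
  IsSubdivision (hypersimplex k n) C ∧
    ∀ Q ∈ C, ∃ M : Matroid (Fin n), IsPositroid k M ∧ Q = matroidPolytope M

/-- A split positroidal subdivision of `Δ(k, n)`: it has exactly two maximal cells. -/
def IsSplitPositroidalSubdivision (k n : ℕ) (C : Set (Set (Fin n → ℝ))) : Prop :=
  IsPositroidalSubdivision k n C ∧ {Q | Maximal (· ∈ C) Q}.ncard = 2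

/-- The polytope in `ℝⁿ × ℝ` obtained by lifting each vertex `e_J` of `Δ(k, n)` to height `w J`. -/
def liftedPolytope {k n : ℕ} (w : KSubset k n → ℝ) : Set ((Fin n → ℝ) × ℝ) :=
  convexHull ℝ (Set.range fun J => (vertex J, w J))

/-- The lower face of the lifted polytope in direction `u`: the points at which the linear
functional `(x, t) ↦ u · x + t` is minimal. -/
def lowerFace {k n : ℕ} (w : KSubset k n → ℝ) (u : Fin n → ℝ) : Set ((Fin n → ℝ) × ℝ) :=
  {p ∈ liftedPolytope w | ∀ q ∈ liftedPolytope w,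
    ∑ i, u i * p.1 i + p.2 ≤ ∑ i, u i * q.1 i + q.2}

/-- The regular subdivision of `Δ(k, n)` with weight `w`: the projections of the lower faces. -/
def regularSubdivision {k n : ℕ} (w : KSubset k n → ℝ) : Set (Set (Fin n → ℝ)) :=
  Set.range fun u => Prod.fst '' lowerFace w u

/-- The shear `(x, t) ↦ (x, t + u · x)`. -/
def shear {n : ℕ} (u : Fin n → ℝ) : ((Fin n → ℝ) × ℝ) →ₗ[ℝ] ((Fin n → ℝ) × ℝ) where
  toFun p := (p.1, p.2 + ∑ i, u i * p.1 i)
  map_add' p q := by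
    ext <;> simp [mul_add, Finset.sum_add_distrib]
    ring
  map_smul' a p := by
    ext <;> simp [mul_left_comm, Finset.mul_sum, mul_add]

theorem liftedPolytope_add {k n : ℕ} (w : KSubset k n → ℝ) (u : Fin n → ℝ) :
    liftedPolytope (w + linearWeight k n u) = shear u '' liftedPolytope w := by
  unfold liftedPolytope
  rw [(shear u).image_convexHull, ← Set.range_comp]
  rfl

theorem lowerFace_add {k n : ℕ} (w : KSubset k n → ℝ) (u v : Fin n → ℝ) :
    lowerFace (w + linearWeight k n u) v = shear u '' lowerFace w (u + v) := by
  have key : ∀ p : (Fin n → ℝ) × ℝ, ∑ i, v i * (shear u p).1 i + (shear u p).2 =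
      ∑ i, (u + v) i * p.1 i + p.2 := by
    intro p
    simp only [shear, LinearMap.coe_mk, AddHom.coe_mk, Pi.add_apply, add_mul,
      Finset.sum_add_distrib]
    ring
  unfold lowerFace
  rw [liftedPolytope_add]
  ext p
  constructor
  · rintro ⟨⟨p, hp, rfl⟩, h⟩
    refine ⟨p, ⟨hp, fun q hq => ?_⟩, rfl⟩
    rw [← key, ← key]
    exact h _ ⟨q, hq, rfl⟩
  · rintro ⟨p, ⟨hp, h⟩, rfl⟩
    refine ⟨⟨p, hp, rfl⟩, ?_⟩
    rintro _ ⟨q, hq, rfl⟩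
    rw [key, key]
    exact h q hq

theorem regularSubdivision_add {k n : ℕ} (w : KSubset k n → ℝ) (u : Fin n → ℝ) :
    regularSubdivision (w + linearWeight k n u) = regularSubdivision w := by
  have key : ∀ v, Prod.fst '' lowerFace (w + linearWeight k n u) v =
      Prod.fst '' lowerFace w (u + v) := by
    intro v
    rw [lowerFace_add, Set.image_image]
    rfl
  unfold regularSubdivision
  simp only [key]
  exact (Equiv.addLeft u).surjective.range_comp fun v => Prod.fst '' lowerFace w v

/-- The regular subdivision of `Δ(k, n)` induced by a class of weights modulo the lineality
space. -/
def inducedSubdivision {k n : ℕ} (ω : (KSubset k n → ℝ) ⧸ lineality k n) :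
    Set (Set (Fin n → ℝ)) :=
  Quotient.liftOn' ω regularSubdivision (by
    intro w w' h
    rw [Submodule.quotientRel_def] at h
    obtain ⟨u, hu⟩ := h
    rw [show w = w' + linearWeight k n u by rw [hu]; abel, regularSubdivision_add])

end PositroidalSubdivision

end

open PositroidalSubdivision

/-!
The column with entries `i < j` is equivalent to the union of the fundamental tableaux `T_l` with
`i ≤ l ≤ j - 2`, so `v_T` is the indicator vector of this range of indices. The minors of the web
matrix are `1` or sums of consecutive variables, so their tropicalizations at `v_T` are `0` or `1`,
and the value `1` occurs exactly for the pairs contained in a block `A` of consecutive elements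
(`trop_plucker_webMatrix`). That `T` is not frozen means that `A` and its complement both have at
least two elements.

On the vertices of `Δ(2, n)` this weight is the convex function `max(0, x_A - 1)`, where
`x_A = ∑_{a ∈ A} x_a`, which suggests that the subdivision is the split of `Δ(2, n)` along the
hyperplane `x_A = 1`. The two parts `x_A ≤ 1` and `x_A ≥ 1` are cells. They cover `Δ(2, n)`, because
a convex combination which uses pairs inside `A` as well as pairs outside `A` can be uncrossed with
`e_ab + e_cd = e_ac + e_bd` (`hypersimplex_subset_parts`). The same exchange shows that no cell has
vertices of both kinds (`cell_subset_part`), so that these two are the maximal cells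
(`maximal_cells`). That cells meet in common faces holds for every regular subdivision
(`isExposed_cell_inter`).

That all cells, and not only the maximal ones, are positroid polytopes is shown by a degeneration
(`exists_isPositroid_minimizers`). Take points `z_1 < z_2 < ⋯` on the real line such that those
in `A` are at mutual distances of order `e^{-s}`, and let `u` be the direction of a cell. The
numbers `(z_d - z_c) e^{-s (u_c + u_d - m)}`, with `m` the minimal cost, satisfy the Plücker
relations and are positive for `c < d`; for `s → ∞` they converge to a vector whose support is the
set of vertices of the cell. The limit satisfies the Plücker relations again, hence is, up to a
positive factor, the vector of minors of a matrix (`exists_isPositroid`).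
-/

namespace PositroidalSubdivision

open Filter Topology
open scoped Pointwise

/-! ### Pairs and Plücker coordinates -/

/-- The two-element subset `{a, b}`. -/
def pair {n : ℕ} {a b : Fin n} (h : a ≠ b) : KSubset 2 n := ⟨{a, b}, Finset.card_pair h⟩

theorem exists_eq_pair {n : ℕ} (J : KSubset 2 n) : ∃ (a b : Fin n) (h : a < b), J = pair h.ne := by
  obtain ⟨a, b, hab, hJ⟩ := Finset.card_eq_two.1 J.2
  rcases hab.lt_or_gt with h | h
  · exact ⟨a, b, h, Subtype.ext hJ⟩
  · exact ⟨b, a, h, Subtype.ext (hJ.trans (Finset.pair_comm a b))⟩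

theorem plucker_pair {R : Type*} [CommRing R] {n : ℕ} (A : Matrix (Fin 2) (Fin n) R)
    {a b : Fin n} (h : a < b) : plucker A (pair h.ne) = A 0 a * A 1 b - A 0 b * A 1 a := by
  have key : (![a, b] : Fin 2 → Fin n) = (pair h.ne).1.orderEmbOfFin (pair h.ne).2 := by
    refine Finset.orderEmbOfFin_unique _ ?_ ?_
    · intro x
      fin_cases x <;> simp [pair]
    · intro x y hxy
      fin_cases x <;> fin_cases y <;> simp_all
  rw [plucker, ← key, Matrix.det_fin_two]
  simp

/-! ### The weight of a one-column tableau -/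

/-- The weight on two-element subsets with value `1` on the subsets of `A` and `0` elsewhere.
On the vertices of `Δ(2, n)` it is the convex function `max(0, x_A - 1)`, with
`x_A = ∑_{a ∈ A} x_a`. -/
def splitWeight {n : ℕ} (A : Finset (Fin n)) (J : KSubset 2 n) : ℝ := if J.1 ⊆ A then 1 else 0

/-- The elements `i + 1, …, j` of `{1, …, n}`, which are `i, …, j - 1` in `Fin n`. -/
def block (n i j : ℕ) : Finset (Fin n) := Finset.univ.filter fun a => i ≤ (a : ℕ) ∧ (a : ℕ) < j

theorem mem_block {n i j : ℕ} {a : Fin n} : a ∈ block n i j ↔ i ≤ (a : ℕ) ∧ (a : ℕ) < j := by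
  simp [block]

theorem trop_one {σ : Type*} [Fintype σ] (y : σ → ℝ) : trop (1 : MvPolynomial σ ℝ) y = 0 := by
  classical
  have h : (1 : MvPolynomial σ ℝ).support = {0} := by
    ext m
    simp
  have : Nonempty (1 : MvPolynomial σ ℝ).support := ⟨0, by simp [h]⟩
  unfold trop
  have : ∀ m : (1 : MvPolynomial σ ℝ).support, ∑ l, (m.1 l : ℝ) * y l = 0 := by
    rintro ⟨m, hm⟩
    rw [h, Finset.mem_singleton] at hm
    simp [hm]
  simp [this]

theorem mem_support_sum_X {σ : Type*} (S : Finset σ) (m : σ →₀ ℕ) :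
    m ∈ (∑ l ∈ S, MvPolynomial.X l : MvPolynomial σ ℝ).support ↔
      ∃ l ∈ S, m = Finsupp.single l 1 := by
  classical
  simp only [MvPolynomial.mem_support_iff, MvPolynomial.coeff_sum, MvPolynomial.coeff_X,
    Finset.sum_boole, ne_eq, Nat.cast_eq_zero, Finset.card_eq_zero]
  rw [← ne_eq, ← Finset.nonempty_iff_ne_empty]
  simp [Finset.Nonempty, eq_comm]

theorem trop_sum_X {σ : Type*} [Fintype σ] (S : Finset σ) (hS : S.Nonempty) (y : σ → ℝ) :
    trop (∑ l ∈ S, MvPolynomial.X l) y = S.inf' hS y := by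
  classical
  have eval : ∀ l, ∑ x, ((Finsupp.single l 1 : σ →₀ ℕ) x : ℝ) * y x = y l := by
    intro l
    simp [Finsupp.single_apply]
  have hsupp := mem_support_sum_X S
  generalize (∑ l ∈ S, MvPolynomial.X l : MvPolynomial σ ℝ) = f at hsupp ⊢
  have : Nonempty f.support := ⟨_, (hsupp _).2 ⟨_, hS.choose_spec, rfl⟩⟩
  apply le_antisymm
  · rw [Finset.le_inf'_iff]
    intro l hl
    have hm : Finsupp.single l 1 ∈ f.support := (hsupp _).2 ⟨l, hl, rfl⟩
    rw [← eval l]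
    exact ciInf_le (f := fun m : f.support => ∑ x, (m.1 x : ℝ) * y x)
      (Set.finite_range _).bddBelow ⟨_, hm⟩
  · refine le_ciInf ?_
    rintro ⟨m, hm⟩
    obtain ⟨l, hl, rfl⟩ := (hsupp _).1 hm
    rw [eval]
    exact Finset.inf'_le _ hl

/-- The minors of the web matrix which are not constant are sums of consecutive variables. -/
theorem plucker_webMatrix {n : ℕ} {a b : Fin n} (h : a < b) :
    plucker (webMatrix n) (pair h.ne) = if (a : ℕ) = 0 then 1 else
      ∑ l ∈ Finset.univ.filter (fun l : Fin (n - 2) => (a : ℕ) < l + 2 ∧ (l : ℕ) + 2 ≤ b),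
        MvPolynomial.X l := by
  have hab : (a : ℕ) < b := h
  have col : ∀ c : Fin n, (c : ℕ) ≠ 0 → webMatrix n 1 c = 1 ∧ webMatrix n 0 c =
      -∑ l ∈ Finset.univ.filter (fun l : Fin (n - 2) => (l : ℕ) + 2 ≤ c), MvPolynomial.X l := by
    intro c hc
    by_cases h1 : (c : ℕ) = 1
    · simp [webMatrix, h1]
    · simp [webMatrix, hc, h1]
  rw [plucker_pair _ h, (col b (by omega)).1, (col b (by omega)).2]
  split_ifs with ha
  · simp [webMatrix, ha]
  · rw [(col a ha).1, (col a ha).2]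
    have := Finset.sum_sdiff (f := fun l : Fin (n - 2) => (MvPolynomial.X l : MvPolynomial _ ℝ))
      (show Finset.univ.filter (fun l : Fin (n - 2) => (l : ℕ) + 2 ≤ a) ⊆
        Finset.univ.filter (fun l : Fin (n - 2) => (l : ℕ) + 2 ≤ b) from
        Finset.monotone_filter_right _ fun l _ hl => hl.trans hab.le)
    rw [mul_one, mul_one, neg_sub_neg, ← this, add_sub_cancel_right]
    congr 1
    ext l
    simp
    omega

theorem vT_oneColumn {n i j : ℕ} (hi : 1 ≤ i) (hij : i < j) (hj : j ≤ n) (l : Fin (n - 2)) :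
    vT (oneColumn hi hij hj) l = if i ≤ (l : ℕ) + 1 ∧ (l : ℕ) + 2 < j then 1 else 0 := by
  let f : ℕ → ℕ := fun x => if i ≤ x ∧ x + 1 < j then 1 else 0
  have hf0 : f 0 = 0 := if_neg (by omega)
  have hfn : ∀ x, n ≤ x + 1 → f x = 0 := fun x hx => if_neg (by omega)
  have key : TabEquiv (oneColumn hi hij hj).1 (smallGap fun l : Fin (n - 2) => f (l + 1)) := by
    rw [tabEquiv_iff]
    constructor
    · rintro (_ | x)
      · rw [(smallGap_count _ 0).1, (smallGap_count_low _).2.1, extZero_of f hf0 hfn, hf0]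
        simp only [oneColumn, column, Matrix.cons_val_zero, Matrix.cons_val_one,
          Multiset.count_singleton]
        split_ifs <;> omega
      · rw [(smallGap_count _ _).1, (smallGap_count _ x).2, extZero_of f hf0 hfn,
          extZero_of f hf0 hfn]
        simp only [oneColumn, column, Matrix.cons_val_zero, Matrix.cons_val_one,
          Multiset.count_singleton, f]
        split_ifs <;> omega
    · rw [(smallGap_count_low _).1]
      simp [oneColumn, column, Multiset.count_singleton]
      omega
  have := (existsUnique_smallGap (oneColumn hi hij hj)).unique
    (existsUnique_smallGap (oneColumn hi hij hj)).choose_spec.1 key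
  rw [vT, this]
  simp [f, add_assoc]

theorem trop_plucker_webMatrix {n i j : ℕ} (hi : 1 ≤ i) (hij : i < j) (hj : j ≤ n)
    (J : KSubset 2 n) :
    trop (plucker (webMatrix n) J) (vT (oneColumn hi hij hj)) = splitWeight (block n i j) J := by
  obtain ⟨a, b, h, rfl⟩ := exists_eq_pair J
  have hab : (a : ℕ) < b := h
  have hb := b.2
  have hw : splitWeight (block n i j) (pair h.ne) = if i ≤ (a : ℕ) ∧ (b : ℕ) < j then 1 else 0 := by
    simp only [splitWeight, pair, Finset.insert_subset_iff, Finset.singleton_subset_iff, mem_block]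
    congr 1
    apply propext
    omega
  rw [plucker_webMatrix h, hw]
  by_cases ha : (a : ℕ) = 0
  · rw [if_pos ha, trop_one, if_neg (by omega)]
  · have hS : (Finset.univ.filter
        (fun l : Fin (n - 2) => (a : ℕ) < l + 2 ∧ (l : ℕ) + 2 ≤ b)).Nonempty :=
      ⟨⟨a - 1, by omega⟩, by simp; omega⟩
    rw [if_neg ha, trop_sum_X _ hS]
    split_ifs with hc
    · apply le_antisymm
      · obtain ⟨l, hl⟩ := hS
        refine (Finset.inf'_le _ hl).trans ?_
        rw [vT_oneColumn]
        split_ifs <;> norm_num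
      · rw [Finset.le_inf'_iff]
        intro l hl
        have := (Finset.mem_filter.1 hl).2
        rw [vT_oneColumn, if_pos (by omega)]
    · apply le_antisymm
      · -- a variable of value zero: the first one if `a < i`, the last one if `j ≤ b`
        by_cases hai : (a : ℕ) < i
        · refine (Finset.inf'_le (b := ⟨a - 1, by omega⟩) _ (by simp; omega)).trans ?_
          rw [vT_oneColumn, if_neg (by simp; omega)]
        · refine (Finset.inf'_le (b := ⟨b - 2, by omega⟩) _ (by simp; omega)).trans ?_
          rw [vT_oneColumn, if_neg (by simp; omega)]
      · rw [Finset.le_inf'_iff]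
        intro l _
        rw [vT_oneColumn]
        split_ifs <;> norm_num

theorem inducedSubdivision_oneColumn {n i j : ℕ} (hi : 1 ≤ i) (hij : i < j) (hj : j ≤ n) :
    inducedSubdivision (speyerWilliams n (vT (oneColumn hi hij hj))) =
      regularSubdivision (splitWeight (block n i j)) := by
  have : (fun J => trop (plucker (webMatrix n) J) (vT (oneColumn hi hij hj))) =
      splitWeight (block n i j) := funext (trop_plucker_webMatrix hi hij hj)
  rw [speyerWilliams, this]
  rfl

theorem non_frozen_bounds {n i j : ℕ} (hi : 1 ≤ i) (hij : i < j) (hj : j ≤ n)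
    (hT : ¬ IsFrozen n (oneColumn hi hij hj).1) : i + 2 ≤ j ∧ (2 ≤ i ∨ j < n) := by
  have hc : StrictMono ![i, j] := by
    intro x y hxy
    fin_cases x <;> fin_cases y <;> simp_all
  constructor
  · by_contra hlt
    obtain rfl : j = i + 1 := by omega
    refine hT ⟨_, hc, rfl, i - 1, ?_⟩
    ext x
    simp only [Set.mem_range, Fin.exists_fin_two, Set.mem_ofPred_eq]
    simp [Nat.mod_eq_of_lt (show i - 1 < n by omega), Nat.sub_add_cancel hi,
      Nat.mod_eq_of_lt (show i < n by omega), eq_comm]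
  · by_contra hlt
    obtain ⟨rfl, rfl⟩ : i = 1 ∧ j = n := by omega
    refine hT ⟨_, hc, rfl, j - 1, ?_⟩
    ext x
    simp only [Set.mem_range, Fin.exists_fin_two, Set.mem_ofPred_eq]
    simp [Nat.mod_eq_of_lt (show j - 1 < j by omega), eq_comm, or_comm,
      Nat.sub_add_cancel (show 1 ≤ j by omega)]

/-! ### Regular subdivisions -/

/-- The points of a convex hull at which a linear functional is minimal over it are the convex
combinations of the generators at which it is minimal. -/
theorem minimalFace_convexHull {E : Type*} [AddCommGroup E] [Module ℝ E] (S : Set E)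
    (l : E →ₗ[ℝ] ℝ) :
    {p ∈ convexHull ℝ S | ∀ q ∈ convexHull ℝ S, l p ≤ l q} =
      convexHull ℝ {p ∈ S | ∀ q ∈ S, l p ≤ l q} := by
  have hull : ∀ m, (∀ q ∈ S, m ≤ l q) → ∀ q ∈ convexHull ℝ S, m ≤ l q := fun m hm q hq =>
    convexHull_min (t := {q | m ≤ l q}) hm (convex_halfSpace_ge l.isLinear m) hq
  apply Set.Subset.antisymm
  · rintro p ⟨hp, hmin⟩
    obtain ⟨ι, _, c, z, hc0, hc1, hz, hp⟩ := mem_convexHull_iff_exists_fintype.1 hp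
    have hlp : ∑ k, c k * (l (z k) - l p) = 0 := by
      simp only [mul_sub, Finset.sum_sub_distrib, ← Finset.sum_mul, hc1, one_mul]
      rw [← hp]
      simp
    have hzero := (Finset.sum_eq_zero_iff_of_nonneg fun k _ => mul_nonneg (hc0 k)
      (sub_nonneg.2 (hmin _ (subset_convexHull ℝ S (hz k))))).1 hlp
    have hp' : Finset.univ.centerMass c z = p := by
      rw [Finset.centerMass_eq_of_sum_1 _ _ hc1, hp]
    rw [← hp', ← Finset.centerMass_filter_ne_zero]
    refine Finset.centerMass_mem_convexHull _ (fun k _ => hc0 k) ?_ fun k hk => ?_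
    · rw [Finset.sum_filter_ne_zero, hc1]
      exact one_pos
    · have hk0 := (Finset.mem_filter.1 hk).2
      have hlk : l (z k) = l p :=
        sub_eq_zero.1 ((mul_eq_zero.1 (hzero k (Finset.mem_univ k))).resolve_left hk0)
      exact ⟨hz k, fun q hq => hlk ▸ hmin q (subset_convexHull ℝ S hq)⟩
  · refine convexHull_min ?_ ?_
    · exact fun p hp => ⟨subset_convexHull ℝ S hp.1, hull _ hp.2⟩
    · rintro p ⟨hp, hpm⟩ q ⟨hq, hqm⟩ a b ha hb hab
      refine ⟨convex_convexHull ℝ S hp hq ha hb hab, fun r hr => ?_⟩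
      rw [map_add, map_smul, map_smul, smul_eq_mul, smul_eq_mul]
      calc a * l p + b * l q ≤ a * l r + b * l r :=
            add_le_add (mul_le_mul_of_nonneg_left (hpm r hr) ha)
              (mul_le_mul_of_nonneg_left (hqm r hr) hb)
        _ = l r := by rw [← add_mul, hab, one_mul]

/-- The value at the lifted vertex `(e_J, w_J)` of the functional `(x, t) ↦ u · x + t`. -/
def cost {k n : ℕ} (w : KSubset k n → ℝ) (u : Fin n → ℝ) (J : KSubset k n) : ℝ :=
  ∑ i, u i * vertex J i + w J

/-- The sets `J` whose lifted vertices lie on the lower face in direction `u`. -/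
def minimizers {k n : ℕ} (w : KSubset k n → ℝ) (u : Fin n → ℝ) : Set (KSubset k n) :=
  {J | ∀ K, cost w u J ≤ cost w u K}

/-- The cell of the regular subdivision belonging to the direction `u`. -/
def cell {k n : ℕ} (w : KSubset k n → ℝ) (u : Fin n → ℝ) : Set (Fin n → ℝ) :=
  convexHull ℝ (vertex '' minimizers w u)

theorem image_fst_lowerFace {k n : ℕ} (w : KSubset k n → ℝ) (u : Fin n → ℝ) :
    Prod.fst '' lowerFace w u = cell w u := by
  let l : (Fin n → ℝ) × ℝ →ₗ[ℝ] ℝ :=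
    { toFun := fun p => ∑ i, u i * p.1 i + p.2
      map_add' := fun p q => by
        simp only [Prod.fst_add, Prod.snd_add, Pi.add_apply, mul_add, Finset.sum_add_distrib]
        ring
      map_smul' := fun a p => by
        simp [mul_left_comm, Finset.mul_sum, mul_add] }
  have h := minimalFace_convexHull (Set.range fun J => (vertex J, w J)) l
  have h' : lowerFace w u = convexHull ℝ ((fun J => (vertex J, w J)) '' minimizers w u) := by
    refine h.trans ?_
    congr 1
    ext p
    constructor
    · rintro ⟨⟨J, rfl⟩, hJ⟩
      exact ⟨J, fun K => hJ _ ⟨K, rfl⟩, rfl⟩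
    · rintro ⟨J, hJ, rfl⟩
      refine ⟨⟨J, rfl⟩, ?_⟩
      rintro _ ⟨K, rfl⟩
      exact hJ K
  rw [h', cell]
  refine ((LinearMap.fst ℝ (Fin n → ℝ) ℝ).image_convexHull _).trans ?_
  rw [← Set.image_comp]
  rfl

theorem regularSubdivision_eq_range_cell {k n : ℕ} (w : KSubset k n → ℝ) :
    regularSubdivision w = Set.range (cell w) := by
  unfold regularSubdivision
  simp only [image_fst_lowerFace]

/-- Over the projection of a lower face the lower hull is affine, so two cells meet where the
difference of the two defining functionals is extremal on either of them. -/
theorem isExposed_cell_inter {k n : ℕ} (w : KSubset k n → ℝ) (u v : Fin n → ℝ) :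
    IsExposed ℝ (cell w u) (cell w u ∩ cell w v) := by
  rw [← image_fst_lowerFace, ← image_fst_lowerFace]
  rintro ⟨x₀, ⟨⟨_, t₀⟩, hu₀, rfl⟩, ⟨_, s₀⟩, hv₀, rfl⟩
  let l : (Fin n → ℝ) →ₗ[ℝ] ℝ :=
    { toFun := fun x => ∑ i, u i * x i - ∑ i, v i * x i
      map_add' := fun x y => by
        simp only [Pi.add_apply, mul_add, Finset.sum_add_distrib]
        ring
      map_smul' := fun a x => by
        simp [mul_left_comm, Finset.mul_sum, mul_sub] }
  refine ⟨LinearMap.toContinuousLinearMap l, ?_⟩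
  have hl : ∀ x, LinearMap.toContinuousLinearMap l x = ∑ i, u i * x i - ∑ i, v i * x i :=
    fun x => rfl
  simp only [hl]
  ext x
  constructor
  · rintro ⟨⟨⟨x, t⟩, hu, rfl⟩, ⟨x', s⟩, hv, hx⟩
    obtain rfl : x' = x := hx
    refine ⟨⟨_, hu, rfl⟩, ?_⟩
    rintro _ ⟨⟨y, r⟩, hy, rfl⟩
    have h1 := hu.2 _ hy.1
    have h2 := hy.2 _ hu.1
    have h3 := hv.2 _ hy.1
    have h4 := hu.2 _ hv.1
    have h5 := hv.2 _ hu.1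
    simp only at h1 h2 h3 h4 h5 ⊢
    linarith
  · rintro ⟨⟨⟨x, t⟩, hu, rfl⟩, hx⟩
    refine ⟨⟨_, hu, rfl⟩, ⟨x, t⟩, ⟨hu.1, fun q hq => ?_⟩, rfl⟩
    have h1 := hx _ ⟨_, hu₀, rfl⟩
    have h2 := hu.2 _ hu₀.1
    have h3 := hu₀.2 _ hu.1
    have h4 := hv₀.2 _ hq
    have h5 := hv₀.2 _ hu₀.1
    have h6 := hu₀.2 _ hv₀.1
    simp only at h1 h2 h3 h4 h5 h6 ⊢
    linarith

theorem vertex_mem_Icc {k n : ℕ} (J : KSubset k n) (i : Fin n) :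
    vertex J i ∈ Set.Icc (0 : ℝ) 1 := by
  unfold vertex
  split_ifs <;> simp

/-- The vertices of a hypersimplex are vertices of the unit cube. -/
theorem vertex_mem_extremePoints {k n : ℕ} (J : KSubset k n) :
    vertex J ∈ (hypersimplex k n).extremePoints ℝ := by
  have hsub : hypersimplex k n ⊆ Set.univ.pi fun _ => Set.Icc (0 : ℝ) 1 := by
    refine convexHull_min ?_ (convex_pi fun _ _ => convex_Icc 0 1)
    rintro _ ⟨K, rfl⟩ i _
    exact vertex_mem_Icc K i
  refine inter_extremePoints_subset_extremePoints_of_subset hsub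
    ⟨subset_convexHull ℝ _ ⟨J, rfl⟩, ?_⟩
  rw [extremePoints_pi]
  intro i _
  rw [Set.extremePoints_Icc zero_le_one]
  unfold vertex
  split_ifs <;> simp

theorem isSubdivision_regularSubdivision {k n : ℕ} (w : KSubset k n → ℝ)
    (hcover : hypersimplex k n ⊆ ⋃₀ regularSubdivision w) :
    IsSubdivision (hypersimplex k n) (regularSubdivision w) := by
  have hsub : ∀ u, cell w u ⊆ hypersimplex k n := fun u =>
    convexHull_mono (Set.image_subset_range _ _)
  rw [regularSubdivision_eq_range_cell] at hcover ⊢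
  refine ⟨?_, ?_, ?_, (hcover.antisymm (Set.sUnion_subset ?_)).symm, ?_⟩
  · exact (Set.finite_range fun S : Set (KSubset k n) => convexHull ℝ (vertex '' S)).subset
      (Set.range_subset_iff.2 fun u => ⟨minimizers w u, rfl⟩)
  · rintro _ ⟨u, rfl⟩
    exact ⟨_, Set.toFinite _, rfl⟩
  · rintro _ ⟨u, rfl⟩ _ ⟨v, rfl⟩
    exact ⟨isExposed_cell_inter w u v, Set.inter_comm (cell w v) _ ▸ isExposed_cell_inter w v u⟩
  · rintro _ ⟨u, rfl⟩
    exact hsub u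
  · rintro _ ⟨u, rfl⟩ x hx
    obtain ⟨J, -, rfl⟩ := extremePoints_convexHull_subset hx
    exact vertex_mem_extremePoints J

/-! ### The two maximal cells -/

theorem combination_mem_of_midpoint_mem {E : Type*} [AddCommGroup E] [Module ℝ E]
    {C : Set E} (hC : Convex ℝ C) {p q r : E} (hp : p ∈ C) (hr : r ∈ C)
    (hpq : midpoint ℝ p q ∈ C) {a b c : ℝ} (hb : 0 ≤ b) (hc : 0 ≤ c) (hca : c ≤ a)
    (habc : a + b + c = 1) : a • p + b • r + c • q ∈ C := by
  have h := hC.sum_mem (t := Finset.univ) (w := ![a - c, b, 2 * c])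
    (z := ![p, r, midpoint ℝ p q]) (by intro k _; fin_cases k <;> simp <;> linarith)
    (by simp [Fin.sum_univ_three]; linarith)
    (by intro k _; fin_cases k <;> assumption)
  convert h using 1
  simp only [Fin.sum_univ_three, Matrix.cons_val, midpoint_eq_smul_add, invOf_eq_inv]
  module

/-- If the midpoints of `D` and `I` are convex combinations of `M`, then in any convex combination
of `D ∪ M ∪ I` the lighter one of the shares of `D` and `I` can be moved to `M`. -/
theorem convexHull_union_subset {E : Type*} [AddCommGroup E] [Module ℝ E] {D M I : Set E}
    (hD : D.Nonempty) (hM : M.Nonempty) (hI : I.Nonempty)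
    (h : ∀ p ∈ D, ∀ q ∈ I, midpoint ℝ p q ∈ convexHull ℝ M) :
    convexHull ℝ (D ∪ M ∪ I) ⊆ convexHull ℝ (D ∪ M) ∪ convexHull ℝ (M ∪ I) := by
  have hmid : ∀ p ∈ convexHull ℝ D, ∀ q ∈ convexHull ℝ I, midpoint ℝ p q ∈ convexHull ℝ M := by
    intro p hp q hq
    have key : convexHull ℝ (D + I) ⊆ {x | (2⁻¹ : ℝ) • x ∈ convexHull ℝ M} := by
      refine convexHull_min ?_ ?_
      · rintro _ ⟨a, ha, b, hb, rfl⟩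
        have := h a ha b hb
        rwa [midpoint_eq_smul_add, invOf_eq_inv] at this
      · exact (convex_convexHull ℝ M).is_linear_preimage
          (IsLinearMap.isLinearMap_smul (2⁻¹ : ℝ))
    rw [midpoint_eq_smul_add, invOf_eq_inv]
    exact key ((convexHull_add (R := ℝ) D I).symm ▸ Set.add_mem_add hp hq)
  rw [convexHull_union (hD.mono Set.subset_union_left) hI, convexHull_union hD hM]
  intro x hx
  obtain ⟨y, hy, q, hq, a, c, ha, hc, hac, rfl⟩ := mem_convexJoin.1 hx
  obtain ⟨p, hp, r, hr, d, e, hd, he, hde, rfl⟩ := mem_convexJoin.1 hy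
  rw [← convexHull_union hD hM]
  have hpq := hmid p hp q hq
  have hsum : a * d + a * e + c = 1 := by rw [← mul_add, hde, mul_one, hac]
  have hx : a • (d • p + e • r) + c • q = (a * d) • p + (a * e) • r + c • q := by module
  rw [hx]
  rcases le_total c (a * d) with hle | hle
  · exact Or.inl (combination_mem_of_midpoint_mem (convex_convexHull ℝ _)
      (convexHull_mono Set.subset_union_left hp) (convexHull_mono Set.subset_union_right hr)
      (convexHull_mono Set.subset_union_right hpq) (mul_nonneg ha he) hc hle hsum)
  · right
    have := combination_mem_of_midpoint_mem (convex_convexHull ℝ (M ∪ I))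
      (convexHull_mono Set.subset_union_right hq) (convexHull_mono Set.subset_union_left hr)
      (convexHull_mono Set.subset_union_left (midpoint_comm (R := ℝ) p q ▸ hpq))
      (mul_nonneg ha he) (mul_nonneg ha hd) hle (by linarith)
    convert this using 1
    abel

theorem vertex_pair {n : ℕ} {a b : Fin n} (h : a ≠ b) :
    vertex (pair h) = Pi.single a 1 + Pi.single b 1 := by
  funext x
  by_cases ha : x = a
  · subst ha
    simp [vertex, pair, h]
  · by_cases hb : x = b
    · subst hb
      simp [vertex, pair, h.symm]
    · simp [vertex, pair, ha, hb]

theorem cost_pair {n : ℕ} (w : KSubset 2 n → ℝ) (u : Fin n → ℝ) {a b : Fin n} (h : a ≠ b) :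
    cost w u (pair h) = u a + u b + w (pair h) := by
  simp [cost, vertex_pair, mul_add, Finset.sum_add_distrib, Pi.single_apply]

theorem splitWeight_pair {n : ℕ} (A : Finset (Fin n)) {a b : Fin n} (h : a ≠ b) :
    splitWeight A (pair h) = if a ∈ A ∧ b ∈ A then 1 else 0 := by
  simp [splitWeight, pair, Finset.insert_subset_iff]

theorem pair_subset_iff {n : ℕ} (A : Finset (Fin n)) {a b : Fin n} (h : a ≠ b) :
    (pair h).1 ⊆ A ↔ a ∈ A ∧ b ∈ A := by
  simp [pair, Finset.insert_subset_iff]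

theorem pair_disjoint_iff {n : ℕ} (A : Finset (Fin n)) {a b : Fin n} (h : a ≠ b) :
    Disjoint (pair h).1 A ↔ a ∉ A ∧ b ∉ A := by
  simp [pair]

variable {n : ℕ} {A : Finset (Fin n)}

theorem minimizers_zero (hA : ∃ J : KSubset 2 n, ¬ J.1 ⊆ A) :
    minimizers (splitWeight A) 0 = {J | ¬ J.1 ⊆ A} := by
  have h : ∀ J, cost (splitWeight A) 0 J = if J.1 ⊆ A then 1 else 0 := by
    intro J
    simp [cost, splitWeight]
  obtain ⟨K, hK⟩ := hA
  ext J
  simp only [minimizers, Set.mem_ofPred_eq, h]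
  constructor
  · intro hJ hJA
    have := hJ K
    rw [if_pos hJA, if_neg hK] at this
    linarith
  · intro hJ L
    rw [if_neg hJ]
    split_ifs <;> norm_num

theorem minimizers_neg_indicator (hA : ∃ J : KSubset 2 n, ¬ Disjoint J.1 A) :
    minimizers (splitWeight A) (fun a => if a ∈ A then -1 else 0) = {J | ¬ Disjoint J.1 A} := by
  have h : ∀ J, cost (splitWeight A) (fun a => if a ∈ A then -1 else 0) J =
      if Disjoint J.1 A then 0 else -1 := by
    intro J
    obtain ⟨a, b, hab, rfl⟩ := exists_eq_pair J
    rw [cost_pair, splitWeight_pair]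
    simp only [pair_disjoint_iff]
    by_cases ha : a ∈ A <;> by_cases hb : b ∈ A <;> simp [ha, hb]
  obtain ⟨K, hK⟩ := hA
  ext J
  simp only [minimizers, Set.mem_ofPred_eq, h]
  constructor
  · intro hJ hJA
    have := hJ K
    rw [if_pos hJA, if_neg hK] at this
    linarith
  · intro hJ L
    rw [if_neg hJ]
    split_ifs <;> norm_num

/-- The part `x_A ≤ 1` of `Δ(2, n)`, as the convex hull of the vertices in it. -/
def lowerPart (A : Finset (Fin n)) : Set (Fin n → ℝ) :=
  convexHull ℝ (vertex '' {J : KSubset 2 n | ¬ J.1 ⊆ A})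

/-- The part `x_A ≥ 1` of `Δ(2, n)`, as the convex hull of the vertices in it. -/
def upperPart (A : Finset (Fin n)) : Set (Fin n → ℝ) :=
  convexHull ℝ (vertex '' {J : KSubset 2 n | ¬ Disjoint J.1 A})

theorem not_subset_of_disjoint {J : KSubset 2 n} (h : Disjoint J.1 A) : ¬ J.1 ⊆ A := by
  intro hs
  have h2 := J.2
  rw [Finset.disjoint_self_iff_empty J.1 |>.1 (h.mono_right hs)] at h2
  simp at h2

theorem hypersimplex_subset_parts (hI : ∃ J : KSubset 2 n, J.1 ⊆ A)
    (hD : ∃ J : KSubset 2 n, Disjoint J.1 A) :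
    hypersimplex 2 n ⊆ lowerPart A ∪ upperPart A := by
  -- uncrossing: `e_ab + e_cd = e_ac + e_bd`
  have hmid : ∀ p ∈ vertex '' {J : KSubset 2 n | Disjoint J.1 A},
      ∀ q ∈ vertex '' {J : KSubset 2 n | J.1 ⊆ A}, midpoint ℝ p q ∈
        convexHull ℝ (vertex '' {J : KSubset 2 n | ¬ J.1 ⊆ A ∧ ¬ Disjoint J.1 A}) := by
    rintro _ ⟨J, hJ, rfl⟩ _ ⟨K, hK, rfl⟩
    obtain ⟨a, b, hab, rfl⟩ := exists_eq_pair J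
    obtain ⟨c, d, hcd, rfl⟩ := exists_eq_pair K
    rw [Set.mem_ofPred_eq, pair_disjoint_iff] at hJ
    rw [Set.mem_ofPred_eq, pair_subset_iff] at hK
    have hac : a ≠ c := fun h => hJ.1 (h ▸ hK.1)
    have hbd : b ≠ d := fun h => hJ.2 (h ▸ hK.2)
    have : midpoint ℝ (vertex (pair hab.ne)) (vertex (pair hcd.ne)) =
        midpoint ℝ (vertex (pair hac)) (vertex (pair hbd)) := by
      simp only [midpoint_eq_smul_add, vertex_pair]
      congr 1
      abel
    rw [this]
    refine (convex_convexHull ℝ _).midpoint_mem (subset_convexHull ℝ _ ⟨_, ?_, rfl⟩)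
      (subset_convexHull ℝ _ ⟨_, ?_, rfl⟩)
    · simp [pair_subset_iff, pair_disjoint_iff, hJ, hK]
    · simp [pair_subset_iff, pair_disjoint_iff, hJ, hK]
  have hDne : (vertex '' {J : KSubset 2 n | Disjoint J.1 A}).Nonempty :=
    hD.elim fun J hJ => ⟨_, J, hJ, rfl⟩
  have hIne : (vertex '' {J : KSubset 2 n | J.1 ⊆ A}).Nonempty :=
    hI.elim fun J hJ => ⟨_, J, hJ, rfl⟩
  have hM : (vertex '' {J : KSubset 2 n | ¬ J.1 ⊆ A ∧ ¬ Disjoint J.1 A}).Nonempty := by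
    obtain ⟨p, hp⟩ := hDne
    obtain ⟨q, hq⟩ := hIne
    exact convexHull_nonempty_iff.1 ⟨_, hmid p hp q hq⟩
  have := convexHull_union_subset hDne hM hIne hmid
  rw [← Set.image_union, ← Set.image_union, ← Set.image_union] at this
  rw [hypersimplex, ← Set.image_univ]
  convert this using 3
  · ext J
    simp
    tauto
  · unfold lowerPart
    congr 2
    ext J
    have := not_subset_of_disjoint (J := J) (A := A)
    simp
    tauto
  · unfold upperPart
    congr 2
    ext J
    have := not_subset_of_disjoint (J := J) (A := A)
    simp
    tauto

/-- A set of minimizers contains no `{a, b}` outside `A` together with a `{c, d}` inside `A`, for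
`{a, c}` and `{b, d}` would have a smaller total cost. -/
theorem cell_subset_part (u : Fin n → ℝ) :
    cell (splitWeight A) u ⊆ lowerPart A ∨ cell (splitWeight A) u ⊆ upperPart A := by
  by_contra! hcon
  have h1 : ∃ J ∈ minimizers (splitWeight A) u, J.1 ⊆ A := by
    by_contra! h
    exact hcon.1 (convexHull_mono (Set.image_mono h))
  have h2 : ∃ J ∈ minimizers (splitWeight A) u, Disjoint J.1 A := by
    by_contra! h
    exact hcon.2 (convexHull_mono (Set.image_mono h))
  obtain ⟨K, hK, hKA⟩ := h1
  obtain ⟨J, hJ, hJA⟩ := h2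
  obtain ⟨a, b, hab, rfl⟩ := exists_eq_pair J
  obtain ⟨c, d, hcd, rfl⟩ := exists_eq_pair K
  rw [pair_disjoint_iff] at hJA
  rw [pair_subset_iff] at hKA
  have hac : a ≠ c := fun h => hJA.1 (h ▸ hKA.1)
  have hbd : b ≠ d := fun h => hJA.2 (h ▸ hKA.2)
  have e1 := hJ (pair hac)
  have e2 := hK (pair hbd)
  simp only [cost_pair, splitWeight_pair, hJA.1, hJA.2, hKA.1, hKA.2] at e1 e2
  norm_num at e1 e2
  linarith

/-- The directions `0` and `-e_A` give the two parts of `Δ(2, n)`, which cover it; every other cell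
lies in one of them. -/
theorem maximal_cells (hI : ∃ J : KSubset 2 n, J.1 ⊆ A) (hD : ∃ J : KSubset 2 n, Disjoint J.1 A) :
    hypersimplex 2 n ⊆ ⋃₀ regularSubdivision (splitWeight A) ∧
      {Q | Maximal (· ∈ regularSubdivision (splitWeight A)) Q}.ncard = 2 := by
  rw [regularSubdivision_eq_range_cell]
  have hlow : lowerPart A ∈ Set.range (cell (splitWeight A)) := by
    refine ⟨0, ?_⟩
    rw [cell, minimizers_zero (hD.imp fun J => not_subset_of_disjoint), lowerPart]
  have hupp : upperPart A ∈ Set.range (cell (splitWeight A)) := by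
    refine ⟨fun a => if a ∈ A then -1 else 0, ?_⟩
    rw [cell, minimizers_neg_indicator
      (hI.imp fun J hJ h => not_subset_of_disjoint h hJ), upperPart]
  have hext : ∀ (J : KSubset 2 n) (S : Set (KSubset 2 n)),
      vertex J ∈ convexHull ℝ (vertex '' S) → J ∈ S := by
    intro J S hJ
    have h := inter_extremePoints_subset_extremePoints_of_subset
      (convexHull_mono (Set.image_subset_range vertex S)) ⟨hJ, vertex_mem_extremePoints J⟩
    obtain ⟨K, hK, hKJ⟩ := extremePoints_convexHull_subset h
    suffices K = J from this ▸ hK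
    ext x
    have := congrFun hKJ x
    unfold vertex at this
    split_ifs at this <;> simp_all
  have hlu : ¬ lowerPart A ⊆ upperPart A := by
    obtain ⟨J, hJ⟩ := hD
    intro h
    exact hext J _ (h (subset_convexHull ℝ _ ⟨J, not_subset_of_disjoint hJ, rfl⟩)) hJ
  have hul : ¬ upperPart A ⊆ lowerPart A := by
    obtain ⟨J, hJ⟩ := hI
    intro h
    exact hext J _ (h (subset_convexHull ℝ _
      ⟨J, fun hJ' => not_subset_of_disjoint hJ' hJ, rfl⟩)) hJ
  constructor
  · intro x hx
    rcases hypersimplex_subset_parts hI hD hx with h | h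
    · exact ⟨_, hlow, h⟩
    · exact ⟨_, hupp, h⟩
  · have : {Q | Maximal (· ∈ Set.range (cell (splitWeight A))) Q} = {lowerPart A, upperPart A} := by
      ext Q
      constructor
      · rintro ⟨⟨u, rfl⟩, hmax⟩
        rcases cell_subset_part (A := A) u with h | h
        · exact Or.inl (h.antisymm (hmax hlow h))
        · exact Or.inr (h.antisymm (hmax hupp h))
      · rintro (rfl | rfl)
        · refine ⟨hlow, ?_⟩
          rintro _ ⟨u, rfl⟩ h
          exact (cell_subset_part u).resolve_right fun h' => hlu (h.trans h')
        · refine ⟨hupp, ?_⟩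
          rintro _ ⟨u, rfl⟩ h
          exact (cell_subset_part u).resolve_left fun h' => hul (h.trans h')
    rw [this]
    exact Set.ncard_pair fun h => hlu h.le

/-! ### Positroids of rank two from Plücker coordinates -/

/-- A nonzero vector of Plücker coordinates, non-negative on increasing pairs, is up to a positive
factor the vector of minors of a matrix: if `q a b ≠ 0`, take the columns `(q c b, q a c)`.
Its support is the set of bases of a positroid. -/
theorem exists_isPositroid (q : Fin n → Fin n → ℝ) (S : Set (KSubset 2 n)) (hne : S.Nonempty)
    (hS : ∀ (c d : Fin n) (h : c ≠ d), pair h ∈ S ↔ q c d ≠ 0)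
    (hanti : ∀ c d, q d c = -q c d)
    (hplucker : ∀ a b c d, q a b * q c d - q a c * q b d + q a d * q b c = 0)
    (hpos : ∀ c d, c < d → 0 ≤ q c d) :
    ∃ M : Matroid (Fin n), IsPositroid 2 M ∧
      ∀ B, M.IsBase B ↔ ∃ J ∈ S, (J.1 : Set (Fin n)) = B := by
  have hself : ∀ c, q c c = 0 := fun c => by linarith [hanti c c]
  have hexch : Matroid.ExchangeProperty fun B => ∃ J ∈ S, (J.1 : Set (Fin n)) = B := by
    have key : ∀ (c d e f : Fin n), q c d ≠ 0 → q e f ≠ 0 → c ≠ e → c ≠ f →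
        ∃ g, (g = e ∨ g = f) ∧ g ≠ c ∧ g ≠ d ∧ q g d ≠ 0 := by
      intro c d e f hcd hef hce hcf
      have hg : q e d ≠ 0 ∨ q f d ≠ 0 := by
        by_contra! h
        have := hplucker e f c d
        rw [h.1, h.2, mul_zero, zero_mul, sub_zero, add_zero] at this
        exact mul_ne_zero hef hcd this
      rcases hg with h | h
      · exact ⟨e, Or.inl rfl, hce.symm, fun hed => h (hed ▸ hself _), h⟩
      · exact ⟨f, Or.inr rfl, hcf.symm, fun hfd => h (hfd ▸ hself _), h⟩
    rintro _ _ ⟨J, hJ, rfl⟩ ⟨K, hK, rfl⟩ x hx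
    obtain ⟨c, d, hcd, rfl⟩ := exists_eq_pair J
    obtain ⟨e, f, hef, rfl⟩ := exists_eq_pair K
    rw [hS] at hJ hK
    simp only [pair, Finset.coe_insert, Finset.coe_singleton, Set.mem_sdiff, Set.mem_insert_iff,
      Set.mem_singleton_iff, not_or] at hx ⊢
    have hdc : q d c ≠ 0 := by rw [hanti, neg_ne_zero]; exact hJ
    obtain ⟨rfl | rfl, hxe, hxf⟩ := hx
    · obtain ⟨g, hg, hgc, hgd, hq⟩ := key x d e f hJ hK hxe hxf
      refine ⟨g, ⟨hg, hgc, hgd⟩, pair hgd, (hS _ _ _).2 hq, ?_⟩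
      rw [Set.insert_sdiff_self_of_notMem (by simpa using hcd.ne)]
      simp [pair]
    · obtain ⟨g, hg, hgc, hgd, hq⟩ := key x c e f hdc hK hxe hxf
      refine ⟨g, ⟨hg, hgd, hgc⟩, pair hgd, (hS _ _ _).2 hq, ?_⟩
      rw [Set.pair_comm, Set.insert_sdiff_self_of_notMem (by simpa using hcd.ne')]
      simp [pair]
  have hexists : ∃ B : Set (Fin n), ∃ J ∈ S, (J.1 : Set (Fin n)) = B :=
    ⟨_, hne.choose, hne.choose_spec, rfl⟩
  refine ⟨Matroid.ofIsBaseOfFinite Set.finite_univ _ hexists hexch fun _ _ => Set.subset_univ _,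
    ⟨rfl, ?_⟩, fun B => Iff.rfl⟩
  obtain ⟨J, hJ⟩ := hne
  obtain ⟨a, b, hab, rfl⟩ := exists_eq_pair J
  have hqab : 0 < q a b := lt_of_le_of_ne (hpos a b hab) ((hS _ _ _).1 hJ).symm
  let N : Matrix (Fin 2) (Fin n) ℝ := Matrix.of ![fun c => q c b, fun c => q a c]
  have hN : ∀ (c d : Fin n) (h : c < d), plucker N (pair h.ne) = q a b * q c d := by
    intro c d h
    rw [plucker_pair _ h]
    simp only [N, Matrix.of_apply, Matrix.cons_val_zero, Matrix.cons_val_one]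
    rw [hanti b c, hanti b d]
    linarith [hplucker a b c d]
  refine ⟨N, fun J => ?_, fun B => ?_⟩
  · obtain ⟨c, d, h, rfl⟩ := exists_eq_pair J
    rw [hN c d h]
    exact mul_nonneg hqab.le (hpos c d h)
  · refine exists_congr fun J => ?_
    rw [and_comm]
    refine and_congr_right fun _ => ?_
    obtain ⟨c, d, h, rfl⟩ := exists_eq_pair J
    rw [hS, hN c d h, mul_ne_zero_iff]
    exact (and_iff_right hqab.ne').symm

/-! ### Every cell is a positroid polytope -/

theorem tendsto_mul_exp {g : ℝ → ℝ} {L e : ℝ} (hg : Tendsto g atTop (𝓝 L)) (he : 0 ≤ e) :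
    Tendsto (fun s => g s * Real.exp (-(e * s))) atTop (𝓝 (if e = 0 then L else 0)) := by
  split_ifs with h
  · simpa [h] using hg
  · have h1 : Tendsto (fun s => Real.exp (-(e * s))) atTop (𝓝 0) :=
      Real.tendsto_exp_neg_atTop_nhds_zero.comp
        (tendsto_id.const_mul_atTop (lt_of_le_of_ne he (Ne.symm h)))
    simpa using hg.mul h1

/-- Points on the real line, for `s ≥ 0` in increasing order, of which those labelled by `block n i j`
converge to a single one as `s → ∞`. -/
noncomputable def collapsingPoint (n i j : ℕ) (s : ℝ) (c : Fin n) : ℝ :=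
  if c ∈ block n i j then i + Real.exp (-s) * ((c : ℝ) - i) else c

/-- The coefficient of the leading term of `collapsingPoint n i j s d - collapsingPoint n i j s c`
as `s → ∞`. -/
noncomputable def leadingGap (n i j : ℕ) (c d : Fin n) : ℝ :=
  if c ∈ block n i j ∧ d ∈ block n i j then (d : ℝ) - c
  else (if d ∈ block n i j then (i : ℝ) else d) - if c ∈ block n i j then (i : ℝ) else c

theorem leadingGap_swap (i j : ℕ) (c d : Fin n) :
    leadingGap n i j d c = -leadingGap n i j c d := by
  unfold leadingGap
  by_cases hc : c ∈ block n i j <;> by_cases hd : d ∈ block n i j <;> simp [hc, hd]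

theorem leadingGap_pos {i j : ℕ} {c d : Fin n} (h : c < d) : 0 < leadingGap n i j c d := by
  have hcd : (c : ℕ) < d := h
  unfold leadingGap
  simp only [mem_block]
  split_ifs <;> rw [sub_pos, Nat.cast_lt] <;> omega

theorem tendsto_collapsingPoint_sub (i j : ℕ) (c d : Fin n) :
    ∃ g : ℝ → ℝ, Tendsto g atTop (𝓝 (leadingGap n i j c d)) ∧
      ∀ s, collapsingPoint n i j s d - collapsingPoint n i j s c =
        g s * Real.exp (-((if c ∈ block n i j ∧ d ∈ block n i j then 1 else 0) * s)) := by
  by_cases h : c ∈ block n i j ∧ d ∈ block n i j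
  · refine ⟨fun _ => (d : ℝ) - c, ?_, fun s => ?_⟩
    · rw [leadingGap, if_pos h]
      exact tendsto_const_nhds
    · simp only [collapsingPoint, if_pos h.1, if_pos h.2, if_pos h, one_mul]
      ring
  · refine ⟨fun s => collapsingPoint n i j s d - collapsingPoint n i j s c, ?_, fun s => ?_⟩
    · rw [leadingGap, if_neg h]
      have hlim : ∀ c : Fin n, Tendsto (fun s => collapsingPoint n i j s c) atTop
          (𝓝 (if c ∈ block n i j then (i : ℝ) else c)) := by
        intro c
        unfold collapsingPoint
        split_ifs
        · simpa using (Real.tendsto_exp_neg_atTop_nhds_zero.mul_const ((c : ℝ) - i)).const_add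
            (i : ℝ)
        · exact tendsto_const_nhds
      exact (hlim d).sub (hlim c)
    · simp [if_neg h]

/-- The differences of the collapsing points are the minors of the matrices with columns `(1, z_c)`.
Rescaled by the costs, they converge to non-negative Plücker coordinates supported on the minimizers. -/
theorem exists_isPositroid_minimizers (i j : ℕ) (u : Fin n → ℝ)
    (hne : (minimizers (splitWeight (block n i j)) u).Nonempty) :
    ∃ M : Matroid (Fin n), IsPositroid 2 M ∧
      ∀ B, M.IsBase B ↔ ∃ J ∈ minimizers (splitWeight (block n i j)) u,
        (J.1 : Set (Fin n)) = B := by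
  obtain ⟨K, hK⟩ := id hne
  set A := block n i j
  set m := cost (splitWeight A) u K
  -- the excess of the cost of `{c, d}` over the minimal cost
  let e : Fin n → Fin n → ℝ := fun c d => u c + u d + (if c ∈ A ∧ d ∈ A then 1 else 0) - m
  have he : ∀ (c d : Fin n) (h : c ≠ d), e c d = cost (splitWeight A) u (pair h) - m := by
    intro c d h
    rw [cost_pair, splitWeight_pair]
  have he0 : ∀ c d : Fin n, c ≠ d → 0 ≤ e c d := by
    intro c d h
    rw [he c d h, sub_nonneg]
    exact hK _
  let p : ℝ → Fin n → Fin n → ℝ := fun s c d =>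
    (collapsingPoint n i j s d - collapsingPoint n i j s c) * Real.exp (-((u c + u d - m) * s))
  let q : Fin n → Fin n → ℝ := fun c d => if e c d = 0 then leadingGap n i j c d else 0
  have hlim : ∀ c d, Tendsto (fun s => p s c d) atTop (𝓝 (q c d)) := by
    intro c d
    by_cases hcd : c = d
    · subst hcd
      simp [p, q, leadingGap]
    · obtain ⟨g, hg, hgs⟩ := tendsto_collapsingPoint_sub i j c d
      refine (tendsto_mul_exp hg (he0 c d hcd)).congr fun s => ?_
      simp only [p, e, hgs, mul_assoc, ← Real.exp_add]
      congr 2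
      ring
  refine exists_isPositroid q _ hne ?_ ?_ ?_ ?_
  · intro c d h
    have hgap : leadingGap n i j c d ≠ 0 := by
      rcases h.lt_or_gt with h | h
      · exact (leadingGap_pos h).ne'
      · rw [leadingGap_swap, neg_ne_zero]
        exact (leadingGap_pos h).ne'
    simp only [q, ne_eq, ite_eq_right_iff, hgap, imp_false, not_not, he c d h, sub_eq_zero]
    constructor
    · exact fun hJ => le_antisymm (hJ K) (hK _)
    · exact fun hJ L => hJ.le.trans (hK L)
  · intro c d
    have : e d c = e c d := by simp only [e, and_comm, add_comm]
    simp only [q, this, leadingGap_swap i j c d]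
    split_ifs <;> simp
  · intro a b c d
    refine tendsto_nhds_unique ((((hlim a b).mul (hlim c d)).sub ((hlim a c).mul (hlim b d))).add
      ((hlim a d).mul (hlim b c))) (tendsto_const_nhds.congr fun s => ?_)
    -- the rescaling multiplies column `c` by `exp (-(u c * s))` and all minors by `exp (m * s)`,
    -- so that the Plücker relation of the differences is preserved
    have hexp : ∀ c d : Fin n, Real.exp (-((u c + u d - m) * s)) =
        Real.exp (-(u c * s)) * Real.exp (-(u d * s)) * Real.exp (m * s) := by
      intro c d
      rw [← Real.exp_add, ← Real.exp_add]
      congr 1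
      ring
    simp only [p, hexp]
    ring
  · intro c d h
    simp only [q]
    split_ifs
    · exact (leadingGap_pos h).le
    · exact le_rfl

theorem cell_eq_matroidPolytope {k : ℕ} (w : KSubset k n → ℝ) (u : Fin n → ℝ)
    (M : Matroid (Fin n))
    (hM : ∀ B, M.IsBase B ↔ ∃ J ∈ minimizers w u, (J.1 : Set (Fin n)) = B) :
    cell w u = matroidPolytope M := by
  unfold cell matroidPolytope
  congr 1
  ext x
  simp only [hM]
  constructor
  · rintro ⟨J, hJ, rfl⟩
    refine ⟨_, ⟨J, hJ, rfl⟩, ?_⟩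
    funext a
    simp [vertex]
  · rintro ⟨_, ⟨J, hJ, rfl⟩, rfl⟩
    refine ⟨J, hJ, ?_⟩
    funext a
    simp [vertex]

end PositroidalSubdivision

open PositroidalSubdivision
theorem theorem5p2 (n i j : ℕ) (hi : 1 ≤ i) (hij : i < j) (hj : j ≤ n)
    (hT : ¬ IsFrozen n (oneColumn hi hij hj).1) :
    IsSplitPositroidalSubdivision 2 n
      (inducedSubdivision (speyerWilliams n (vT (oneColumn hi hij hj)))) := by
  obtain ⟨h1, h2⟩ := non_frozen_bounds hi hij hj hT
  have hI : ∃ J : KSubset 2 n, J.1 ⊆ block n i j := by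
    have hne : (⟨i, by omega⟩ : Fin n) ≠ ⟨i + 1, by omega⟩ := by simp
    refine ⟨pair hne, ?_⟩
    rw [pair_subset_iff, mem_block, mem_block]
    constructor <;> constructor <;> simp <;> omega
  have hD : ∃ J : KSubset 2 n, Disjoint J.1 (block n i j) := by
    -- `0` and one more element, `1` or the last one
    have hne : (⟨0, by omega⟩ : Fin n) ≠ ⟨if 2 ≤ i then 1 else n - 1, by split_ifs <;> omega⟩ := by
      simp only [ne_eq, Fin.mk.injEq]
      split_ifs <;> first | omega | simp
    refine ⟨pair hne, ?_⟩
    simp only [pair_disjoint_iff, mem_block]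
    split_ifs <;> omega
  obtain ⟨hcover, hcard⟩ := maximal_cells hI hD
  rw [inducedSubdivision_oneColumn]
  refine ⟨⟨isSubdivision_regularSubdivision _ hcover, ?_⟩, hcard⟩
  rw [regularSubdivision_eq_range_cell]
  rintro _ ⟨u, rfl⟩
  have : Nonempty (KSubset 2 n) := ⟨hI.choose⟩
  obtain ⟨M, hM, hB⟩ := exists_isPositroid_minimizers i j u
    (Finite.exists_min (cost (splitWeight (block n i j)) u))
  exact ⟨M, hM, cell_eq_matroidPolytope _ u M hB⟩
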